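/- Let $G$ be a virtually free group, that is, a group with a free subgroup of finite index (neither $G$ nor the free subgroup is assumed to be finitely generated). Then $G$ is a Takahasi group: for every ascending chain $H_1 \le H_2 \le H_3 \le \cdots$ of finitely generated subgroups of $G$ for which there is $M \in \mathbb{N}$ with $\mathrm{rk}(H_n) \le M$ for all $n$, there is $p$ such that $H_n = H_p$ for all $n \ge p$. Here $\mathrm{rk}(H) = \min\{|X| : H = \langle X\rangle\}$ is the minimal number of generators of a finitely generated group $H$. -/

import Mathlib

/-- A group is virtually free if it has a free subgroup of finite index. Neither the group nor the
free subgroup is required to be finitely generated. -/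
def IsVirtuallyFree (G : Type*) [Group G] : Prop :=
  ∃ F : Subgroup G, IsFreeGroup F ∧ F.FiniteIndex

/-- A group is a Takahasi group if every ascending chain `H 0 ≤ H 1 ≤ H 2 ≤ ⋯` of finitely
generated subgroups of bounded rank (minimal number of generators) is stationary. -/
def IsTakahasiGroup (G : Type*) [Group G] : Prop :=
  ∀ (H : ℕ → Subgroup G) [∀ n, Group.FG (H n)], Monotone H →
    (∃ M : ℕ, ∀ n, Group.rank (H n) ≤ M) →
      ∃ p : ℕ, ∀ n, p ≤ n → H n = H p

/-!
A chain of finitely generated subgroups is stationary exactly when its union is finitely generated.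

In a free group the union is free, by Nielsen–Schreier. If it had a basis with more than `M`
elements, some member of the chain would contain `M + 1` of them, and so would retract onto a free
group of rank `M + 1`; this is impossible when all members have rank at most `M`.

For a free subgroup `F` of finite index, Schreier's bound `rk (H ∩ F) ≤ [G : F] rk H` turns a chain
of bounded rank in `G` into one in `F`, by intersection. The union of the latter is finitely
generated and has finite index in the union of the former.
-/

section FiniteGeneration

variable {G : Type*} [Group G]

theorem exists_le_of_fg_of_le_iSup {ι : Type*} [Nonempty ι] {H : ι → Subgroup G}
    (hH : Directed (· ≤ ·) H) {K : Subgroup G} (hK : K.FG) (hKH : K ≤ ⨆ i, H i) :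
    ∃ i, K ≤ H i := by
  obtain ⟨S, rfl⟩ := hK
  have hS : (S : Set G) ⊆ ⋃ i, (H i : Set G) := by
    rw [← Subgroup.coe_iSup_of_directed hH]
    exact (Subgroup.closure_le _).1 hKH
  obtain ⟨i, hi⟩ := Directed.exists_mem_subset_of_finset_subset_biUnion hH hS
  exact ⟨i, (Subgroup.closure_le _).2 hi⟩

theorem isTakahasiGroup_iff_fg_iSup :
    IsTakahasiGroup G ↔ ∀ (H : ℕ → Subgroup G) [∀ n, Group.FG (H n)], Monotone H →
      (∃ M : ℕ, ∀ n, Group.rank (H n) ≤ M) → (⨆ n, H n).FG := by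
  refine forall₃_congr fun H hfg hH => imp_congr_right fun _ => ⟨?_, fun hsup => ?_⟩
  · rintro ⟨p, hp⟩
    have hsup : ⨆ n, H n = H p := le_antisymm
      (iSup_le fun n => (hH (le_max_left n p)).trans (hp _ (le_max_right n p)).le) (le_iSup H p)
    rw [hsup]
    exact (Group.fg_iff_subgroup_fg _).1 (hfg p)
  · obtain ⟨p, hp⟩ := exists_le_of_fg_of_le_iSup hH.directed_le hsup le_rfl
    exact ⟨p, fun n hn => ((le_iSup H n).trans hp).antisymm (hH hn)⟩

theorem fg_of_fg_of_finiteIndex (H : Subgroup G) [H.FiniteIndex] [Group.FG H] : Group.FG G := by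
  let T : Set G := Set.range (Quotient.out : G ⧸ H → G)
  have : Finite (G ⧸ H) := H.finite_quotient_of_finiteIndex
  have hT : (Subgroup.closure T).FG :=
    (Subgroup.fg_iff _).2 ⟨T, rfl, Set.finite_range (Quotient.out : G ⧸ H → G)⟩
  have htop : H ⊔ Subgroup.closure T = ⊤ := by
    refine eq_top_iff.2 fun x _ => ?_
    obtain ⟨h, hh⟩ := QuotientGroup.mk_out_eq_mul H x
    have hx : x = (x : G ⧸ H).out * (h : G)⁻¹ := by rw [hh, mul_inv_cancel_right]
    rw [hx]
    exact mul_mem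
      (Subgroup.mem_sup_right (Subgroup.subset_closure (Set.mem_range_self _)))
      (Subgroup.mem_sup_left (inv_mem h.2))
  exact Group.fg_def.2 (htop ▸ ((Group.fg_iff_subgroup_fg H).1 ‹_›).sup hT)

end FiniteGeneration

section FreeGroups

theorem card_monoidHom_le_pow_rank (G A : Type*) [Group G] [Group.FG G] [Monoid A] [Finite A] :
    Nat.card (G →* A) ≤ Nat.card A ^ Group.rank G := by
  obtain ⟨S, hcard, hS⟩ := Group.rank_spec G
  have hinj : Function.Injective fun (f : G →* A) (x : S) => f x := fun f g hfg =>
    MonoidHom.eq_of_eqOn_dense hS fun x hx => congrFun hfg ⟨x, hx⟩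
  calc Nat.card (G →* A) ≤ Nat.card (S → A) := Nat.card_le_card_of_injective _ hinj
    _ = Nat.card A ^ Group.rank G := by
        rw [Nat.card_fun, Nat.card_eq_fintype_card (α := S), Fintype.card_coe, hcard]

theorem rank_freeGroup (ι : Type*) [Finite ι] : Group.rank (FreeGroup ι) = Nat.card ι := by
  classical
  cases nonempty_fintype ι
  refine le_antisymm ?_ ?_
  · have hgen : Subgroup.closure
        ((Finset.univ.image FreeGroup.of : Finset (FreeGroup ι)) : Set (FreeGroup ι)) = ⊤ := by
      simp only [Finset.coe_image, Finset.coe_univ, Set.image_univ, FreeGroup.closure_range_of]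
    rw [Nat.card_eq_fintype_card]
    exact (Group.rank_le hgen).trans Finset.card_image_le
  · have hunits : Nat.card ℤˣ = 2 := by rw [Nat.card_eq_fintype_card, Fintype.card_units_int]
    have hcard : 2 ^ Nat.card ι ≤ 2 ^ Group.rank (FreeGroup ι) :=
      calc 2 ^ Nat.card ι = Nat.card (ι → ℤˣ) := by rw [Nat.card_fun, hunits]
        _ = Nat.card (FreeGroup ι →* ℤˣ) := Nat.card_congr FreeGroup.lift
        _ ≤ 2 ^ Group.rank (FreeGroup ι) := hunits ▸ card_monoidHom_le_pow_rank (FreeGroup ι) ℤˣ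
    exact (Nat.pow_le_pow_iff_right one_lt_two).1 hcard

theorem card_le_rank_of_basis_mem_range {ι G K : Type*} [Group G] [Group K] [Group.FG K]
    (b : FreeGroupBasis ι G) (g : K →* G) (s : Finset ι) (hs : ∀ i ∈ s, b i ∈ g.range) :
    s.card ≤ Group.rank K := by
  classical
  let r : G →* FreeGroup s := b.lift fun i => if hi : i ∈ s then FreeGroup.of ⟨i, hi⟩ else 1
  have hr (i : s) : r (b i) = FreeGroup.of i := by
    simp [r]
  have hsurj : Function.Surjective (r.comp g) := by
    rw [← MonoidHom.range_eq_top, eq_top_iff, ← FreeGroup.closure_range_of, Subgroup.closure_le]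
    rintro _ ⟨i, rfl⟩
    obtain ⟨x, hx⟩ := hs i i.2
    exact ⟨x, by rw [MonoidHom.comp_apply, hx, hr]⟩
  calc s.card = Group.rank (FreeGroup s) := by
        rw [rank_freeGroup, Nat.card_eq_fintype_card, Fintype.card_coe]
    _ ≤ Group.rank K := Group.rank_le_of_surjective _ hsurj

theorem fg_iSup_of_isFreeGroup_of_rank_le {ι F : Type*} [Nonempty ι] [Group F] [IsFreeGroup F]
    {H : ι → Subgroup F} [∀ i, Group.FG (H i)] (hH : Directed (· ≤ ·) H) {M : ℕ}
    (hM : ∀ i, Group.rank (H i) ≤ M) : (⨆ i, H i).FG := by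
  classical
  let L : Subgroup F := ⨆ i, H i
  let b := IsFreeGroup.basis L
  have hcard (s : Finset (IsFreeGroup.Generators L)) : s.card ≤ M := by
    let T : Finset F := s.image fun j => (b j : F)
    have hTL : Subgroup.closure (T : Set F) ≤ L := by
      rw [Subgroup.closure_le, Finset.coe_image]
      exact Set.image_subset_iff.2 fun j _ => (b j).2
    obtain ⟨i, hi⟩ := exists_le_of_fg_of_le_iSup hH ⟨T, rfl⟩ hTL
    have hmem (j) (hj : j ∈ s) : (b j : F) ∈ H i :=
      hi (Subgroup.subset_closure (Finset.mem_image_of_mem _ hj))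
    exact (card_le_rank_of_basis_mem_range b (Subgroup.inclusion (le_iSup H i)) s
      fun j hj => ⟨⟨b j, hmem j hj⟩, rfl⟩).trans (hM i)
  have hfin : Finite (IsFreeGroup.Generators L) := by
    refine not_infinite_iff_finite.1 fun hinf => ?_
    obtain ⟨s, hs⟩ := Infinite.exists_subset_card_eq (IsFreeGroup.Generators L) (M + 1)
    exact (hcard s).not_gt (hs ▸ M.lt_succ_self)
  exact (Group.fg_iff_subgroup_fg L).1
    (Group.fg_of_surjective (f := b.repr.symm.toMonoidHom) b.repr.symm.surjective)

theorem isTakahasiGroup_of_isFreeGroup (F : Type*) [Group F] [IsFreeGroup F] :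
    IsTakahasiGroup F :=
  isTakahasiGroup_iff_fg_iSup.2 fun _ _ hH ⟨_, hM⟩ =>
    fg_iSup_of_isFreeGroup_of_rank_le hH.directed_le hM

end FreeGroups

section FiniteIndex

variable {G : Type*} [Group G]

/-- The symmetry of the intersection `H ⊓ K`. It is an isomorphism rather than an equality because
`H.subgroupOf K` is encoded as a subgroup of the type `K`. -/
def subgroupOfSwapEquiv (H K : Subgroup G) : H.subgroupOf K ≃* K.subgroupOf H where
  toFun x := ⟨⟨x, x.2⟩, x.1.2⟩
  invFun x := ⟨⟨x, x.2⟩, x.1.2⟩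
  left_inv _ := rfl
  right_inv _ := rfl
  map_mul' _ _ := rfl

instance fg_subgroupOf (H K : Subgroup G) [Group.FG H] [(K.subgroupOf H).FiniteIndex] :
    Group.FG (H.subgroupOf K) :=
  Group.fg_of_surjective (f := (subgroupOfSwapEquiv K H).toMonoidHom)
    (subgroupOfSwapEquiv K H).surjective

theorem rank_subgroupOf_le (H K : Subgroup G) [Group.FG H] [(K.subgroupOf H).FiniteIndex] :
    Group.rank (H.subgroupOf K) ≤ K.relIndex H * Group.rank H :=
  (Group.rank_congr (subgroupOfSwapEquiv H K)).trans_le (Subgroup.rank_le_index_mul_rank _)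

theorem fg_of_fg_subgroupOf (H K : Subgroup G) [(K.subgroupOf H).FiniteIndex]
    [Group.FG (H.subgroupOf K)] : H.FG :=
  have : Group.FG (K.subgroupOf H) :=
    Group.fg_of_surjective (f := (subgroupOfSwapEquiv H K).toMonoidHom)
      (subgroupOfSwapEquiv H K).surjective
  (Group.fg_iff_subgroup_fg H).1 (fg_of_fg_of_finiteIndex (K.subgroupOf H))

theorem iSup_subgroupOf_of_directed {ι : Type*} [Nonempty ι] {H : ι → Subgroup G}
    (hH : Directed (· ≤ ·) H) (K : Subgroup G) :
    (⨆ i, H i).subgroupOf K = ⨆ i, (H i).subgroupOf K := by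
  have hK : Directed (· ≤ ·) fun i => (H i).subgroupOf K :=
    hH.mono_comp _ fun _ _ h => Subgroup.comap_mono h
  ext x
  simp only [Subgroup.mem_subgroupOf, Subgroup.mem_iSup_of_directed hH,
    Subgroup.mem_iSup_of_directed hK]

theorem relIndex_le_index (H K : Subgroup G) [H.FiniteIndex] : H.relIndex K ≤ H.index := by
  have htop : H.relIndex ⊤ ≠ 0 := H.relIndex_top_right ▸ Subgroup.FiniteIndex.index_ne_zero
  exact (Subgroup.relIndex_le_of_le_right le_top htop).trans_eq H.relIndex_top_right

theorem IsTakahasiGroup.of_finiteIndex (F : Subgroup G) [F.FiniteIndex]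
    (hF : IsTakahasiGroup F) : IsTakahasiGroup G := by
  refine isTakahasiGroup_iff_fg_iSup.2 fun H _ hH ⟨M, hM⟩ => ?_
  have hrank (n : ℕ) : Group.rank ((H n).subgroupOf F) ≤ F.index * M :=
    (rank_subgroupOf_le (H n) F).trans (Nat.mul_le_mul (relIndex_le_index F (H n)) (hM n))
  have hfg : (⨆ n, (H n).subgroupOf F).FG :=
    isTakahasiGroup_iff_fg_iSup.1 hF _ (fun _ _ hmn => Subgroup.comap_mono (hH hmn)) ⟨_, hrank⟩
  rw [← iSup_subgroupOf_of_directed hH.directed_le, ← Group.fg_iff_subgroup_fg] at hfg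
  exact fg_of_fg_subgroupOf _ F

end FiniteIndex

theorem corollary4p2 {G : Type*} [Group G] (hG : IsVirtuallyFree G) : IsTakahasiGroup G := by
  obtain ⟨F, _, _⟩ := hG
  exact IsTakahasiGroup.of_finiteIndex F (isTakahasiGroup_of_isFreeGroup F)
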